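/- **Setting.** Consider $x_{k+1}=Ax_k+Bu_k+w_k$ with $x_k\in\mathbb{R}^{n_x}$, $u_k\in\mathbb{R}^{n_u}$, and constraints $Fx_k+Gu_k\le \mathbf 1$ ($n_c$ rows; inequalities between vectors are componentwise). Let $\mathbb{W}=\{w\mid V_ww\le\mathbf 1\}$ be compact, $V_w\in\mathbb{R}^{n_v\times n_x}$, and let the disturbances $w_0,w_1,\dots$ together with $M=|\mathcal I_0|$ offline samples $w^1,\dots,w^M$ be jointly i.i.d. with a probability distribution $\mathrm{Pr}$ whose support $\mathbb{W}_{\rm true}$ is contained in $\mathbb{W}$. Let $K$ be a feedback gain, $\Phi=A+BK$, and let $\mathbb{S}=\{e\mid V_se\le \mathbf 1\}$ be compact with $\Phi\mathbb{S}\oplus\mathbb{W}\subseteq\mathbb{S}$. Let $N\ge1$. **Learned sets.** For $v\in\mathbb{W}$, $\boldsymbol\theta\in[0,1]^{n_v}$, $\rho\in[0,1]$ put $\mathcal{W}(v,\boldsymbol\theta,\rho)=\{w\mid V_ww\le\boldsymbol\theta\}\oplus(1-\rho)v$. Let $(v_0^*,\boldsymbol\theta_0^*,\rho_0^*)$ minimise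 $\mathbf 1^T\boldsymbol\theta+\rho$ subject to $V_wv\le\mathbf 1$, $\boldsymbol\theta\in[0,1]^{n_v}$, $\rho\in[0,1]$, $\boldsymbol\theta\le\rho\mathbf 1$ and $V_ww^s\le\boldsymbol\theta+(1-\rho)V_wv$ for $s=1,\dots,M$. For $k\ge1$ let $(v_k^*,\boldsymbol\theta_k^*,\rho_k^*)$ minimise the same objective subject to the same constraints, except that the sample constraints are replaced by $\boldsymbol\theta_{k-1}^*+(1-\rho_{k-1}^*)V_wv_{k-1}^*\le\boldsymbol\theta+(1-\rho)V_wv$ and $V_ww_{k-1}\le\boldsymbol\theta+(1-\rho)V_wv$. If there are several minimisers, one is chosen that minimises a fixed strictly convex function of $((1-\rho)v,\boldsymbol\theta,\rho)$. Put $\hat{\mathbb{W}}_k=\mathcal{W}(v_k^*,\boldsymbol\theta_k^*,\rho_k^*)$ and $\hat w_{\max,k}=\max_{w\in\hat{\mathbb{W}}_k}V_sw$ (componentwise). **MPC problem.** Let $e_{\max}=\max_{e\in\mathbb{S}}V_s\Phi e$ and $h=\max_{e\in\mathbb{S}}(F+GK)e$ (componentwise), $E=[I_{n_u}\ \mathbf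 0\ \cdots\ \mathbf 0]$, $\bar F=[F+GK\ \ GE]$, $\Psi=\begin{bmatrix}\Phi&BE\\ \mathbf 0&M_\uparrow\end{bmatrix}$ with the block-upshift $M_\uparrow(c_0,\dots,c_{N-1})=(c_1,\dots,c_{N-1},\mathbf 0)$. Given $\alpha_i=1$ for $i\ge N$, let $\Omega(\hat w,n)$ be the set of $(z,\boldsymbol\alpha)\in\mathbb{R}^{n_x+Nn_u}\times\mathbb{R}_+^N$ with $\bar F\Psi^iz\le\mathbf 1-\alpha_ih$ for $0\le i\le n$ and $\alpha_ie_{\max}+\hat w\le\alpha_{i+1}\mathbf 1$ for $0\le i\le N-1$. Let $\nu$ be the smallest integer $\nu\ge N-1$ such that $\bar F\Psi^{\nu+1}z\le\mathbf 1-h$ for all $(z,\boldsymbol\alpha)\in\Omega(\hat w_{\max,0},\nu)$; it is presupposed that such an integer exists. The problem $\mathrm{OPT}(\hat{\mathbb{W}}_k,\hat w_{\max,k},\nu)$ is feasible at the state $x_k$ if there are $s_{0|k}$, $\mathbf c_k=(c_{0|k},\dots,c_{N-1|k})$ and $\boldsymbol\alpha_k\in\mathbb{R}^N_+$ with $x_k-s_{0|k}\in\alpha_{0|k}\mathbb{S}$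 and $\bigl((s_{0|k},\mathbf c_k),\boldsymbol\alpha_k\bigr)\in\Omega(\hat w_{\max,k},\nu)$. **Proposition 2 (probabilistic recursive feasibility).** Let $\epsilon,\delta\in(0,1)$ and $$M\ \ge\ \frac1\epsilon\,\frac{\mathrm e}{\mathrm e-1}\Bigl(n_x+n_v+\ln\frac1\delta\Bigr).$$ Then, with probability at least $1-\delta$ with respect to the data, the following holds for every $k\in\mathbb{N}$ and every state $x_k$: if $\mathrm{OPT}(\hat{\mathbb{W}}_k,\hat w_{\max,k},\nu)$ is feasible at $x_k$ and the input $u_k=Kx_k+c_{0|k}$ is applied, where $(s_{0|k},\mathbf c_k,\boldsymbol\alpha_k)$ is any feasible point of this problem (in particular an optimal one, for any cost function), then, for $w_k$ distributed according to $\mathrm{Pr}$, the problem $\mathrm{OPT}(\hat{\mathbb{W}}_{k+1},\hat w_{\max,k+1},\nu)$ is feasible at $x_{k+1}=Ax_k+Bu_k+w_k$ with probability at least $1-\epsilon$. -/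

import Mathlib

open MeasureTheory ProbabilityTheory
open scoped Matrix Pointwise

noncomputable section

/-- The polyhedron `{w | V w ≤ b}`, with componentwise inequality. -/
def polyhedron {m n : ℕ} (V : Matrix (Fin m) (Fin n) ℝ) (b : Fin m → ℝ) : Set (Fin n → ℝ) :=
  {w | V *ᵥ w ≤ b}

/-- The polyhedron `{w | V w ≤ 1}`. -/
def unitPolytope {m n : ℕ} (V : Matrix (Fin m) (Fin n) ℝ) : Set (Fin n → ℝ) :=
  polyhedron V (fun _ => 1)

/-- The componentwise maximum `max_{e ∈ X} L e`. It is only used for nonempty compact `X`,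
where the supremum is attained. -/
def maxOver {m n : ℕ} (X : Set (Fin n → ℝ)) (L : Matrix (Fin m) (Fin n) ℝ) : Fin m → ℝ :=
  fun j => sSup ((fun e => (L *ᵥ e) j) '' X)

/-! ### Learned disturbance sets -/

/-- Parameters `(v, θ, ρ)` of a learned disturbance set. -/
abbrev Params (nx nv : ℕ) : Type := (Fin nx → ℝ) × (Fin nv → ℝ) × ℝ

/-- The set `𝒲(v, θ, ρ) = {w | V_w w ≤ θ} ⊕ {(1 - ρ) v}`. -/
def paramSet {nx nv : ℕ} (Vw : Matrix (Fin nv) (Fin nx) ℝ) (p : Params nx nv) :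
    Set (Fin nx → ℝ) :=
  polyhedron Vw p.2.1 + {(1 - p.2.2) • p.1}

/-- The vector `θ + (1 - ρ) V_w v`. -/
def paramLevel {nx nv : ℕ} (Vw : Matrix (Fin nv) (Fin nx) ℝ) (p : Params nx nv) : Fin nv → ℝ :=
  p.2.1 + (1 - p.2.2) • (Vw *ᵥ p.1)

/-- The admissible parameters: `V_w v ≤ 1`, `θ ∈ [0,1]^{n_v}`, `ρ ∈ [0,1]`, `θ ≤ ρ 1`. -/
def admissibleParams {nx nv : ℕ} (Vw : Matrix (Fin nv) (Fin nx) ℝ) : Set (Params nx nv) :=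
  {p | Vw *ᵥ p.1 ≤ (fun _ => 1) ∧ (∀ j, p.2.1 j ∈ Set.Icc (0 : ℝ) 1) ∧
    p.2.2 ∈ Set.Icc (0 : ℝ) 1 ∧ ∀ j, p.2.1 j ≤ p.2.2}

/-- Feasible parameters at the initial time, given the offline samples. -/
def initConstraints {nx nv M : ℕ} (Vw : Matrix (Fin nv) (Fin nx) ℝ)
    (samples : Fin M → Fin nx → ℝ) : Set (Params nx nv) :=
  {p | (∀ i, Vw *ᵥ samples i ≤ paramLevel Vw p) ∧ p ∈ admissibleParams Vw}

/-- Feasible parameters for the online update, given the previous parameters and the most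
recent disturbance. -/
def updateConstraints {nx nv : ℕ} (Vw : Matrix (Fin nv) (Fin nx) ℝ)
    (prev : Params nx nv) (w : Fin nx → ℝ) : Set (Params nx nv) :=
  {p | paramLevel Vw prev ≤ paramLevel Vw p ∧ Vw *ᵥ w ≤ paramLevel Vw p ∧
    p ∈ admissibleParams Vw}

/-- The objective `1ᵀ θ + ρ`. -/
def paramCost {nx nv : ℕ} (p : Params nx nv) : ℝ := (∑ j, p.2.1 j) + p.2.2

/-- The point `(y, θ, ρ)` with `y = (1 - ρ) v`, in which the problems are linear programs; the set
`𝒲(v, θ, ρ)` depends on `(v, θ, ρ)` only through it. -/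
def linearized {nx nv : ℕ} (p : Params nx nv) : Params nx nv :=
  ((1 - p.2.2) • p.1, p.2.1, p.2.2)

/-- `p` minimises `1ᵀ θ + ρ` over `C` and, among all minimisers, it minimises the tie-break
function `t` of `((1 - ρ) v, θ, ρ)`. -/
def IsSelectedMin {nx nv : ℕ} (t : Params nx nv → ℝ) (C : Set (Params nx nv))
    (p : Params nx nv) : Prop :=
  p ∈ C ∧ (∀ q ∈ C, paramCost p ≤ paramCost q) ∧
    ∀ q ∈ C, paramCost q = paramCost p → t (linearized p) ≤ t (linearized q)

/-- The selected minimiser. -/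
def selectMin {nx nv : ℕ} (t : Params nx nv → ℝ) (C : Set (Params nx nv)) : Params nx nv :=
  Classical.epsilon (IsSelectedMin t C)

/-- One online update of the parameters. -/
def nextParams {nx nv : ℕ} (Vw : Matrix (Fin nv) (Fin nx) ℝ) (t : Params nx nv → ℝ)
    (prev : Params nx nv) (w : Fin nx → ℝ) : Params nx nv :=
  selectMin t (updateConstraints Vw prev w)

/-- The parameters `(v*_k, θ*_k, ρ*_k)` computed from the offline samples and from the
disturbances `w_0, …, w_{k-1}`. -/
def learnedParams {nx nv M : ℕ} (Vw : Matrix (Fin nv) (Fin nx) ℝ) (t : Params nx nv → ℝ)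
    (samples : Fin M → Fin nx → ℝ) (w : ℕ → Fin nx → ℝ) : ℕ → Params nx nv
  | 0 => selectMin t (initConstraints Vw samples)
  | k + 1 => nextParams Vw t (learnedParams Vw t samples w k) (w k)

/-! ### Homothetic tube MPC -/

/-- The matrices of the control problem: dynamics `x⁺ = A x + B u + w`, constraints
`F x + G u ≤ 1`, feedback gain `K`, and base set `𝕊 = {e | V_s e ≤ 1}` of the tube. -/
structure TubeData (nx nu nc ns : ℕ) where
  A : Matrix (Fin nx) (Fin nx) ℝ
  B : Matrix (Fin nx) (Fin nu) ℝ
  F : Matrix (Fin nc) (Fin nx) ℝ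
  G : Matrix (Fin nc) (Fin nu) ℝ
  K : Matrix (Fin nu) (Fin nx) ℝ
  Vs : Matrix (Fin ns) (Fin nx) ℝ

/-- `E = [I 0 ⋯ 0]`, reading off the first block of `(c_0, …, c_{N-1})`. -/
def firstBlock (N nu : ℕ) : Matrix (Fin nu) (Fin N × Fin nu) ℝ :=
  fun a q => if q.1.val = 0 ∧ q.2 = a then 1 else 0

/-- The block-upshift `M (c_0, …, c_{N-1}) = (c_1, …, c_{N-1}, 0)`. -/
def blockUpshift (N nu : ℕ) : Matrix (Fin N × Fin nu) (Fin N × Fin nu) ℝ :=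
  fun p q => if q.1.val = p.1.val + 1 ∧ q.2 = p.2 then 1 else 0

namespace TubeData

variable {nx nu nc ns : ℕ} (D : TubeData nx nu nc ns) (N : ℕ)

/-- `Φ = A + B K`. -/
def Phi : Matrix (Fin nx) (Fin nx) ℝ := D.A + D.B * D.K

/-- The base set `𝕊` of the tube. -/
def baseSet : Set (Fin nx → ℝ) := unitPolytope D.Vs

/-- `e_max = max_{e ∈ 𝕊} V_s Φ e`. -/
def eMax : Fin ns → ℝ := maxOver D.baseSet (D.Vs * D.Phi)

/-- `max_{w ∈ X} V_s w`. -/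
def wMax (X : Set (Fin nx → ℝ)) : Fin ns → ℝ := maxOver X D.Vs

/-- `h = max_{e ∈ 𝕊} (F + G K) e`. -/
def hVec : Fin nc → ℝ := maxOver D.baseSet (D.F + D.G * D.K)

/-- `F̄ = [F + G K, G E]`. -/
def FBar : Matrix (Fin nc) (Fin nx ⊕ Fin N × Fin nu) ℝ :=
  Matrix.fromCols (D.F + D.G * D.K) (D.G * firstBlock N nu)

/-- `Ψ = [[Φ, B E], [0, M]]`. -/
def Psi : Matrix (Fin nx ⊕ Fin N × Fin nu) (Fin nx ⊕ Fin N × Fin nu) ℝ :=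
  Matrix.fromBlocks D.Phi (D.B * firstBlock N nu) 0 (blockUpshift N nu)

/-- The tube constraints on `(z, α)` with disturbance bound `wm` and `n + 1` stages; `α` is the
whole sequence of scalings, with `α_i = 1` for `i ≥ N`. -/
def tubeConstraints (wm : Fin ns → ℝ) (n : ℕ) :
    Set ((Fin nx ⊕ Fin N × Fin nu → ℝ) × (ℕ → ℝ)) :=
  {q | (∀ i ≤ n, ∀ j, ((D.FBar N * D.Psi N ^ i) *ᵥ q.1) j ≤ 1 - q.2 i * D.hVec j) ∧
    (∀ i < N, ∀ j, q.2 i * D.eMax j + wm j ≤ q.2 (i + 1)) ∧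
    (∀ i, 0 ≤ q.2 i) ∧ ∀ i, N ≤ i → q.2 i = 1}

/-- The integers `n ≥ N - 1` such that `F̄ Ψ^{n+1} z ≤ 1 - h` holds on the whole of
`tubeConstraints wm n`. -/
def horizons (wm : Fin ns → ℝ) : Set ℕ :=
  {n | N ≤ n + 1 ∧ ∀ q ∈ D.tubeConstraints N wm n,
    ∀ j, ((D.FBar N * D.Psi N ^ (n + 1)) *ᵥ q.1) j ≤ 1 - D.hVec j}

/-- `(s, c, α)` satisfies all constraints of the problem `OPT(X, w_max, ν)` at the state `x`,
where `w_max = max_{w ∈ X} V_s w`. -/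
def IsFeasiblePoint (X : Set (Fin nx → ℝ)) (ν : ℕ) (x s : Fin nx → ℝ)
    (c : Fin N × Fin nu → ℝ) (α : ℕ → ℝ) : Prop :=
  x - s ∈ α 0 • D.baseSet ∧ (Sum.elim s c, α) ∈ D.tubeConstraints N (D.wMax X) ν

/-- The problem `OPT(X, w_max, ν)` is feasible at the state `x`. -/
def IsFeasible (X : Set (Fin nx → ℝ)) (ν : ℕ) (x : Fin nx → ℝ) : Prop :=
  ∃ s c α, D.IsFeasiblePoint N X ν x s c α

/-- The successor of `x` under the input `u = K x + c_0` and the disturbance `w`. -/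
def nextState (x : Fin nx → ℝ) (c : Fin N × Fin nu → ℝ) (w : Fin nx → ℝ) : Fin nx → ℝ :=
  D.A *ᵥ x + D.B *ᵥ (D.K *ᵥ x + firstBlock N nu *ᵥ c) + w

end TubeData

end

noncomputable section

/-! The argument separates a deterministic part from a single probabilistic estimate.

Deterministic part. Suppose the new disturbance lies in the current learned set. The previous
minimiser is then feasible for the updated problem, whose feasible region is only smaller, so it is
again selected: strict convexity makes the selection unique in the coordinates ((1-ρ)v, θ, ρ), which
determine the set (`paramSet_nextParams_eq`). With the set unchanged, shifting the tube gives a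
feasible point at the successor state (`TubeData.isFeasible_nextState`). The horizon computed from
the initial set still serves, because learned sets only grow and larger disturbance bounds only
tighten the tube constraints.

Probabilistic part. Every learned set contains all offline samples, so a disturbance outside it
exceeds all samples in some row of V_w. This `exceedSet` depends on the samples alone, not on the
time or the state, so one event of probability at least 1 - δ serves all of them.

The mass of `exceedSet` in d coordinates is more than ε with probability at most e^d (1 - cε)^M,
where c = 1 - 1/e. The proof (`pi_exceedSet_le`) is by induction on d: remove the sample that is
largest in the first coordinate, and use that the mass above it is uniformly distributed when there
are no atoms. Atoms are removed by a small uniform perturbation. The sample size then gives δ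
(`exp_mul_pow_le`). -/

/-! ### Probability integral transform for tail functions -/

open Filter Topology in
/-- The tail function of a finite atomless measure on the line is continuous. -/
theorem continuous_measureReal_Ioi (ν : Measure ℝ) [IsFiniteMeasure ν] (hν : ∀ t, ν {t} = 0) :
    Continuous fun c => ν.real (Set.Ioi c) := by
  rw [continuous_iff_continuousAt]
  intro c
  have h : Tendsto (fun x => ν (Set.Ioi x)) (𝓝 c) (𝓝 (ν (Set.Ioi c))) := by
    refine tendsto_measure_of_ae_tendsto_indicator_of_isFiniteMeasure (𝓝 c)
      measurableSet_Ioi (fun _ => measurableSet_Ioi) ?_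
    -- The indicators of the half-lines converge at every point except c, which is null.
    have : ∀ᵐ y ∂ν, y ≠ c := by
      rw [ae_iff]; simpa using hν c
    filter_upwards [this] with y hy
    rcases lt_or_gt_of_ne hy with h | h
    · filter_upwards [lt_mem_nhds h] with x hx
      simp [not_lt.2 h.le, not_lt.2 hx.le]
    · filter_upwards [gt_mem_nhds h] with x hx
      simp [h, hx]
  exact (ENNReal.tendsto_toReal (measure_ne_top _ _)).comp h

open Filter Topology in
theorem tendsto_measureReal_Ioi_atBot (ν : Measure ℝ) [IsFiniteMeasure ν] :
    Tendsto (fun c => ν.real (Set.Ioi c)) atBot (𝓝 (ν.real Set.univ)) := by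
  have h : Tendsto (fun x => ν (Set.Ioi x)) atBot (𝓝 (ν Set.univ)) := by
    refine tendsto_measure_of_ae_tendsto_indicator_of_isFiniteMeasure atBot
      MeasurableSet.univ (fun _ => measurableSet_Ioi) (ae_of_all _ fun y => ?_)
    filter_upwards [eventually_lt_atBot y] with x hx
    simp [hx]
  exact (ENNReal.tendsto_toReal (measure_ne_top _ _)).comp h

open Filter Topology in
theorem tendsto_measureReal_Ioi_atTop (ν : Measure ℝ) [IsFiniteMeasure ν] :
    Tendsto (fun c => ν.real (Set.Ioi c)) atTop (𝓝 0) := by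
  have h : Tendsto (fun x => ν (Set.Ioi x)) atTop (𝓝 (ν ∅)) := by
    refine tendsto_measure_of_ae_tendsto_indicator_of_isFiniteMeasure atTop
      MeasurableSet.empty (fun _ => measurableSet_Ioi) (ae_of_all _ fun y => ?_)
    filter_upwards [eventually_ge_atTop y] with x hx
    simp [hx]
  rw [measure_empty] at h
  exact (ENNReal.tendsto_toReal ENNReal.zero_ne_top).comp h

/-- Every value strictly between `0` and the total mass is the mass of an open upper half-line. -/
theorem exists_measureReal_Ioi_eq (ν : Measure ℝ) [IsFiniteMeasure ν] (hν : ∀ t, ν {t} = 0)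
    {t : ℝ} (h0 : 0 < t) (h1 : t < ν.real Set.univ) : ∃ c, ν.real (Set.Ioi c) = t :=
  mem_range_of_exists_le_of_exists_ge (continuous_measureReal_Ioi ν hν)
    (((tendsto_measureReal_Ioi_atTop ν).eventually_le_const h0).exists)
    (((tendsto_measureReal_Ioi_atBot ν).eventually_const_le h1).exists)

open Filter Topology in
/-- Probability integral transform for the tail function of an atomless measure on the line. -/
theorem map_tail_real (ν : Measure ℝ) [IsFiniteMeasure ν] (hν : ∀ t, ν {t} = 0) :
    ν.map (fun c => ν.real (Set.Ioi c)) = volume.restrict (Set.Icc 0 (ν.real Set.univ)) := by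
  set F : ℝ → ℝ := fun c => ν.real (Set.Ioi c) with hF
  set m := ν.real Set.univ with hm
  have hcont : Continuous F := continuous_measureReal_Ioi ν hν
  have hanti : Antitone F := fun a b h => measureReal_mono (Set.Ioi_subset_Ioi h)
  -- If F c = t, monotonicity gives {F < t} ⊆ (c, ∞) ⊆ {F ≤ t}, and the middle set has mass t; no
  -- inverse of F is needed.
  have hlt : ∀ t, 0 < t → t < m → ν {c | F c < t} ≤ ENNReal.ofReal t := by
    intro t h0 h1
    obtain ⟨c, rfl⟩ := exists_measureReal_Ioi_eq ν hν h0 h1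
    rw [ofReal_measureReal]
    exact measure_mono fun x hx => lt_of_not_ge fun h => (hanti h).not_gt hx
  have hle : ∀ t, 0 < t → t < m → ENNReal.ofReal t ≤ ν {c | F c ≤ t} := by
    intro t h0 h1
    obtain ⟨c, rfl⟩ := exists_measureReal_Ioi_eq ν hν h0 h1
    rw [ofReal_measureReal]
    exact measure_mono fun x hx => hanti (le_of_lt hx)
  refine Measure.ext_of_Iic _ _ fun t => ?_
  rw [Measure.map_apply hcont.measurable measurableSet_Iic,
    Measure.restrict_apply measurableSet_Iic]
  rcases lt_or_ge t 0 with ht | ht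
  · have e1 : F ⁻¹' Set.Iic t = ∅ := by
      ext x
      simpa using ht.trans_le (measureReal_nonneg (μ := ν) (s := Set.Ioi x))
    have e2 : Set.Iic t ∩ Set.Icc 0 m = ∅ := by
      ext x
      simp only [Set.mem_inter_iff, Set.mem_Iic, Set.mem_Icc, Set.mem_empty_iff_false, iff_false]
      intro h; linarith [h.1, h.2.1]
    rw [e1, e2]; simp
  rcases le_or_gt m t with hmt | hmt
  · have e1 : F ⁻¹' Set.Iic t = Set.univ := by
      ext x
      simpa using (measureReal_mono (Set.subset_univ (Set.Ioi x))).trans hmt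
    have e2 : Set.Iic t ∩ Set.Icc 0 m = Set.Icc 0 m :=
      Set.inter_eq_right.2 fun x hx => hx.2.trans hmt
    rw [e1, e2, Real.volume_Icc, sub_zero, hm, ofReal_measureReal]
  have e2 : Set.Iic t ∩ Set.Icc 0 m = Set.Icc 0 t := by
    ext x
    simp only [Set.mem_inter_iff, Set.mem_Iic, Set.mem_Icc]
    constructor
    · intro h; exact ⟨h.2.1, h.1⟩
    · intro h; exact ⟨h.2, h.1, h.2.trans hmt.le⟩
  rw [e2, Real.volume_Icc, sub_zero]
  apply le_antisymm
  -- The upper bound concerns strict sublevel sets, so it is applied at s > t and s decreases to t.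
  · have key : ∀ s, t < s → s < m → ν (F ⁻¹' Set.Iic t) ≤ ENNReal.ofReal s := fun s h1 h2 =>
      (measure_mono fun x hx => lt_of_le_of_lt hx h1).trans (hlt s (ht.trans_lt h1) h2)
    refine ge_of_tendsto (x := 𝓝[>] t) (f := fun s => ENNReal.ofReal s) ?_ ?_
    · exact (ENNReal.continuous_ofReal.tendsto t).mono_left nhdsWithin_le_nhds
    · filter_upwards [Ioo_mem_nhdsGT hmt] with s hs using key s hs.1 hs.2
  · rcases ht.eq_or_lt with rfl | ht
    · simp
    · exact hle t ht hmt

/-- Integral transform: if `a` has no atoms under `μ`, then `x ↦ μ {a > a x}` is uniformly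
distributed on `[0, μ univ]`. -/
theorem map_tail {X : Type*} [MeasurableSpace X] (μ : Measure X) [IsFiniteMeasure μ]
    {a : X → ℝ} (ha : Measurable a) (hatom : ∀ t, μ {x | a x = t} = 0) :
    μ.map (fun x => μ.real {y | a x < a y}) = volume.restrict (Set.Icc 0 (μ.real Set.univ)) := by
  have hν : ∀ t, μ.map a {t} = 0 := fun t => by
    rw [Measure.map_apply ha (measurableSet_singleton t)]; exact hatom t
  have h := map_tail_real (μ.map a) hν
  rw [Measure.map_map (continuous_measureReal_Ioi _ hν).measurable ha] at h
  rw [map_measureReal_apply ha MeasurableSet.univ, Set.preimage_univ] at h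
  convert h using 2
  ext x
  simp only [Function.comp]
  rw [map_measureReal_apply ha measurableSet_Ioi]
  rfl

/-! ### Tail bound for the mass beyond all samples -/

/-- The points that exceed, in some coordinate `a j`, all the samples `x s`. -/
def exceedSet {X : Type*} {d M : ℕ} (a : Fin d → X → ℝ) (x : Fin M → X) : Set X :=
  {y | ∃ j, ∀ s, a j (x s) < a j y}

theorem measurableSet_exceedSet_prod {X : Type*} [MeasurableSpace X] {d M : ℕ}
    {a : Fin d → X → ℝ} (ha : ∀ j, Measurable (a j)) :
    MeasurableSet {p : (Fin M → X) × X | p.2 ∈ exceedSet a p.1} := by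
  have h : {p : (Fin M → X) × X | p.2 ∈ exceedSet a p.1} =
      ⋃ j, ⋂ s, {p | a j (p.1 s) < a j p.2} := by
    ext p; simp [exceedSet]
  rw [h]
  refine MeasurableSet.iUnion fun j => MeasurableSet.iInter fun s => ?_
  exact measurableSet_lt ((ha j).comp ((measurable_pi_apply s).comp measurable_fst))
    ((ha j).comp measurable_snd)

theorem measurableSet_exceedSet {X : Type*} [MeasurableSpace X] {d M : ℕ}
    {a : Fin d → X → ℝ} (ha : ∀ j, Measurable (a j)) (x : Fin M → X) :
    MeasurableSet (exceedSet a x) :=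
  measurable_prodMk_left (measurableSet_exceedSet_prod ha)

theorem measurable_measureReal_exceedSet {X : Type*} [MeasurableSpace X] (μ : Measure X)
    [IsFiniteMeasure μ] {d M : ℕ} {a : Fin d → X → ℝ} (ha : ∀ j, Measurable (a j)) :
    Measurable fun x : Fin M → X => μ.real (exceedSet a x) :=
  (measurable_measure_prodMk_left (measurableSet_exceedSet_prod ha)).ennreal_toReal

/-- The bound of the recursion on the number of coordinates, as a function of the mass `u` above
the largest sample in the first coordinate. -/
def peelBound (m ε C c : ℝ) (M : ℕ) (u : ℝ) : ℝ :=
  if u ≤ ε then C * (m - u - c * (ε - u)) ^ M else (m - u) ^ M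

/-- The factor M + 1 counts the candidates for the largest sample. On [0, ε] the base is affine in u
with slope -(1 - c), running from m - cε to m - ε; this produces the factor 1 / (1 - c). -/
theorem lintegral_peelBound {m ε C c : ℝ} (M : ℕ) (hε : 0 ≤ ε) (hm : ε ≤ m) (hC : 0 ≤ C)
    (hc : c < 1) :
    ((M : ENNReal) + 1) * ∫⁻ u in Set.Icc 0 m, ENNReal.ofReal (peelBound m ε C c M u) =
      ENNReal.ofReal (C / (1 - c) * ((m - c * ε) ^ (M + 1) - (m - ε) ^ (M + 1))
        + (m - ε) ^ (M + 1)) := by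
  have hc' : (0 : ℝ) < 1 - c := by linarith
  have hM : (0 : ℝ) < (M : ℝ) + 1 := by positivity
  have hu : Set.Icc 0 m = Set.Icc 0 ε ∪ Set.Ioc ε m := (Set.Icc_union_Ioc_eq_Icc hε hm).symm
  have hd : Disjoint (Set.Icc 0 ε) (Set.Ioc ε m) := by
    rw [Set.disjoint_left]; intro x hx hy; exact absurd hx.2 (not_le.2 hy.1)
  have i1 : ∫⁻ u in Set.Icc 0 ε, ENNReal.ofReal (peelBound m ε C c M u) =
      ENNReal.ofReal (∫ u in (0 : ℝ)..ε, C * (m - u - c * (ε - u)) ^ M) := by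
    rw [intervalIntegral.integral_of_le hε, ← integral_Icc_eq_integral_Ioc,
      ofReal_integral_eq_lintegral_ofReal]
    · refine setLIntegral_congr_fun measurableSet_Icc fun u hu => ?_
      simp [peelBound, hu.2]
    · exact Continuous.integrableOn_Icc (by fun_prop)
    · refine (ae_restrict_iff' measurableSet_Icc).2 (ae_of_all _ fun u hu => ?_)
      have : 0 ≤ m - u - c * (ε - u) := by nlinarith [hu.1, hu.2]
      simp only [Pi.zero_apply]; positivity
  have i2 : ∫⁻ u in Set.Ioc ε m, ENNReal.ofReal (peelBound m ε C c M u) =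
      ENNReal.ofReal (∫ u in ε..m, (m - u) ^ M) := by
    rw [intervalIntegral.integral_of_le hm, ofReal_integral_eq_lintegral_ofReal]
    · refine setLIntegral_congr_fun measurableSet_Ioc fun u hu => ?_
      simp [peelBound, not_le.2 hu.1]
    · exact (Continuous.integrableOn_Icc (by fun_prop)).mono_set Set.Ioc_subset_Icc_self
    · refine (ae_restrict_iff' measurableSet_Ioc).2 (ae_of_all _ fun u hu => ?_)
      have : 0 ≤ m - u := by linarith [hu.2]
      simp only [Pi.zero_apply]; positivity
  have j1 : ∫ u in (0 : ℝ)..ε, C * (m - u - c * (ε - u)) ^ M =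
      C / (1 - c) * ((m - c * ε) ^ (M + 1) - (m - ε) ^ (M + 1)) / (M + 1) := by
    rw [intervalIntegral.integral_eq_sub_of_hasDerivAt
      (f := fun u => - (C / (1 - c) * (m - u - c * (ε - u)) ^ (M + 1) / (M + 1)))]
    · simp only [sub_self, mul_zero, sub_zero]; ring
    · intro u _
      have h1 : HasDerivAt (fun u : ℝ => m - u - c * (ε - u)) (-1 - c * (-1)) u :=
        ((hasDerivAt_id u).const_sub m).sub (((hasDerivAt_id u).const_sub ε).const_mul c)
      refine (((h1.pow (M + 1)).const_mul (C / (1 - c))).div_const ((M : ℝ) + 1)).neg.congr_deriv ?_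
      rw [Nat.add_sub_cancel]
      push_cast
      field_simp
      ring
    · exact Continuous.intervalIntegrable (by fun_prop) _ _
  have j2 : ∫ u in ε..m, (m - u) ^ M = (m - ε) ^ (M + 1) / (M + 1) := by
    rw [intervalIntegral.integral_eq_sub_of_hasDerivAt
      (f := fun u => - ((m - u) ^ (M + 1) / (M + 1)))]
    · simp
    · intro u _
      have h1 : HasDerivAt (fun u : ℝ => m - u) (-1) u := (hasDerivAt_id u).const_sub m
      refine ((h1.pow (M + 1)).div_const ((M : ℝ) + 1)).neg.congr_deriv ?_
      rw [Nat.add_sub_cancel]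
      push_cast
      field_simp
    · exact Continuous.intervalIntegrable (by fun_prop) _ _
  have hp : (m - ε) ^ (M + 1) ≤ (m - c * ε) ^ (M + 1) :=
    pow_le_pow_left₀ (by linarith) (by nlinarith) _
  have hp0 : 0 ≤ (m - ε) ^ (M + 1) := pow_nonneg (by linarith) _
  have hq : 0 ≤ C / (1 - c) * ((m - c * ε) ^ (M + 1) - (m - ε) ^ (M + 1)) :=
    mul_nonneg (by positivity) (by linarith)
  rw [hu, lintegral_union measurableSet_Ioc hd, i1, i2, j1, j2,
    ← ENNReal.ofReal_add (by positivity) (by positivity)]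
  have : ((M : ENNReal) + 1) = ENNReal.ofReal ((M : ℝ) + 1) := by
    rw [ENNReal.ofReal_add (by positivity) zero_le_one]; simp
  rw [this, ← ENNReal.ofReal_mul hM.le]
  congr 1
  field_simp

/-- Removing the sample with the largest first coordinate. -/
theorem exceedSet_insertNth_subset {X : Type*} {d M : ℕ} (a : Fin (d + 1) → X → ℝ)
    (i : Fin (M + 1)) (x : X) (y : Fin M → X) :
    exceedSet a (i.insertNth x y) ⊆ {z | a 0 x < a 0 z} ∪
      (exceedSet (fun j => a j.succ) y ∩ {z | a 0 z ≤ a 0 x}) := by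
  rintro z ⟨j, hj⟩
  rcases lt_or_ge (a 0 x) (a 0 z) with h | h
  · exact Or.inl h
  refine Or.inr ⟨?_, h⟩
  have hx : a j x < a j z := by simpa using hj i
  have hj0 : j ≠ 0 := by
    rintro rfl; exact absurd hx (not_lt.2 h)
  obtain ⟨j', rfl⟩ := Fin.exists_succ_eq.2 hj0
  exact ⟨j', fun s => by simpa using hj (i.succAbove s)⟩

/-- Induction on the number of coordinates. Given the largest first coordinate, with mass u above
it, the other samples lie in the part of mass m - u below it, and the remaining coordinates must
account for mass more than ε - u. Restricting to that part lowers the total mass, hence the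
statement for all finite measures. -/
theorem pi_exceedSet_le {X : Type*} [MeasurableSpace X] {c : ℝ} (hc : c = 1 - Real.exp (-1))
    (d : ℕ) :
    ∀ (M : ℕ) (μ : Measure X) [IsFiniteMeasure μ] (a : Fin d → X → ℝ)
      (_ : ∀ j, Measurable (a j)) (_ : ∀ j t, μ {x | a j x = t} = 0) (ε : ℝ)
      (_ : 0 ≤ ε) (_ : ε ≤ μ.real Set.univ),
    Measure.pi (fun _ : Fin M => μ) {x | ε < μ.real (exceedSet a x)} ≤
      ENNReal.ofReal (Real.exp d * (μ.real Set.univ - c * ε) ^ M) := by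
  have hc1 : c < 1 := by rw [hc]; linarith [Real.exp_pos (-1)]
  induction d with
  | zero =>
    intro M μ _ a _ _ ε hε _
    have : {x : Fin M → X | ε < μ.real (exceedSet a x)} = ∅ := by
      ext x; simp [exceedSet, hε]
    simp [this]
  | succ d ih =>
    intro M μ _ a ha hatom ε hε hεm
    set m := μ.real Set.univ with hm
    rcases M with _ | M
    · calc _ ≤ Measure.pi (fun _ : Fin 0 => μ) Set.univ := measure_mono (Set.subset_univ _)
        _ = 1 := by simp
        _ ≤ _ := by
          rw [pow_zero, mul_one, ← ENNReal.ofReal_one]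
          exact ENNReal.ofReal_le_ofReal (Real.one_le_exp (by positivity))
    set u : X → ℝ := fun x => μ.real {y | a 0 x < a 0 y} with hu
    have hmap : μ.map u = volume.restrict (Set.Icc 0 m) := map_tail μ (ha 0) (hatom 0)
    have humeas : Measurable u := by
      have : MeasurableSet {p : X × X | a 0 p.1 < a 0 p.2} :=
        measurableSet_lt ((ha 0).comp measurable_fst) ((ha 0).comp measurable_snd)
      exact (measurable_measure_prodMk_left this).ennreal_toReal
    have hpeel : Measurable (peelBound m ε (Real.exp d) c M) := by
      unfold peelBound
      refine Measurable.ite measurableSet_Iic ?_ ?_ <;> fun_prop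
    set bad : Set (Fin (M + 1) → X) := {x | ε < μ.real (exceedSet a x)} with hbad
    have hbadm : MeasurableSet bad :=
      measurableSet_lt measurable_const (measurable_measureReal_exceedSet μ ha)
    -- Ties may make these events overlap; only a union bound is used.
    let top : Fin (M + 1) → Set (Fin (M + 1) → X) := fun i =>
      {x | ∀ s, a 0 (x s) ≤ a 0 (x i)} ∩ bad
    have htopm : ∀ i, MeasurableSet (top i) := fun i => by
      refine MeasurableSet.inter ?_ hbadm
      simp only [Set.ofPred_forall]
      exact MeasurableSet.iInter fun s => measurableSet_le
        ((ha 0).comp (measurable_pi_apply s)) ((ha 0).comp (measurable_pi_apply i))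
    have hcover : bad ⊆ ⋃ i, top i := by
      intro x hx
      obtain ⟨i, hi⟩ := Finite.exists_max fun s => a 0 (x s)
      exact Set.mem_iUnion.2 ⟨i, hi, hx⟩
    have hslice : ∀ (i : Fin (M + 1)) (x : X),
        Measure.pi (fun _ : Fin M => μ) {y | i.insertNth (α := fun _ => X) x y ∈ top i} ≤
          ENNReal.ofReal (peelBound m ε (Real.exp d) c M (u x)) := by
      intro i x
      set B : Set X := {z | a 0 z ≤ a 0 x} with hB
      have hBm : MeasurableSet B := measurableSet_le (ha 0) measurable_const
      have hBreal : μ.real B = m - u x := by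
        have : {y | a 0 x < a 0 y} = Bᶜ := by ext; simp [hB]
        rw [hu, hm]
        simp only [this]
        rw [measureReal_compl hBm]; ring
      set ν : Measure X := μ.restrict B with hν
      have hνm : ν.real Set.univ = m - u x := by rw [hν, measureReal_restrict_apply_univ, hBreal]
      set T : Set (Fin M → X) := {y | ε - u x < ν.real (exceedSet (fun j => a j.succ) y)} with hT
      have hTm : MeasurableSet T := measurableSet_lt measurable_const
        (measurable_measureReal_exceedSet ν fun j => ha j.succ)
      have hsub : {y | i.insertNth (α := fun _ => X) x y ∈ top i} ⊆
          T ∩ Set.univ.pi fun _ : Fin M => B := by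
        rintro y ⟨h1, h2⟩
        constructor
        · have h3 : μ.real (exceedSet a (i.insertNth (α := fun _ => X) x y)) ≤
              u x + ν.real (exceedSet (fun j => a j.succ) y) := by
            refine (measureReal_mono (exceedSet_insertNth_subset a i x y)).trans ?_
            refine (measureReal_union_le _ _).trans (le_of_eq ?_)
            rw [hν, measureReal_restrict_apply (measurableSet_exceedSet (fun j => ha j.succ) y)]
          have h4 : ε < μ.real (exceedSet a (i.insertNth (α := fun _ => X) x y)) := h2
          simp only [hT, Set.mem_ofPred_eq]
          linarith
        · intro s _
          have := h1 (i.succAbove s)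
          simp only [Fin.insertNth_apply_succAbove, Fin.insertNth_apply_same] at this
          exact this
      refine (measure_mono hsub).trans ?_
      -- The product measure restricted to B^M is the product of the restrictions, so the induction
      -- hypothesis applies to `ν`. When u > ε it has nothing to say, and the total mass (m - u)^M
      -- is used.
      rw [← Measure.restrict_apply hTm, Measure.restrict_pi_pi]
      unfold peelBound
      split_ifs with hux
      · refine (ih M ν (fun j => a j.succ) (fun j => ha j.succ) (fun j t => ?_) (ε - u x)
          (by linarith) (by rw [hνm]; linarith)).trans (le_of_eq ?_)
        · exact Measure.absolutelyContinuous_of_le Measure.restrict_le_self (hatom j.succ t)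
        · rw [hνm]
      · refine (measure_mono (Set.subset_univ _)).trans (le_of_eq ?_)
        rw [Measure.pi_univ]
        simp only [Finset.prod_const, Finset.card_univ, Fintype.card_fin]
        rw [ENNReal.ofReal_pow, ← hνm, ofReal_measureReal]
        rw [← hνm]; exact measureReal_nonneg
    have htop : ∀ i, Measure.pi (fun _ : Fin (M + 1) => μ) (top i) ≤
        ∫⁻ v in Set.Icc 0 m, ENNReal.ofReal (peelBound m ε (Real.exp d) c M v) := by
      intro i
      have hmp := (measurePreserving_piFinSuccAbove (fun _ : Fin (M + 1) => μ) i).symm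
      rw [← hmp.measure_preimage (htopm i).nullMeasurableSet,
        Measure.prod_apply (hmp.measurable (htopm i)), ← hmap,
        lintegral_map hpeel.ennreal_ofReal humeas]
      exact lintegral_mono fun x => hslice i x
    calc Measure.pi (fun _ : Fin (M + 1) => μ) bad
        ≤ ∑ i, Measure.pi (fun _ : Fin (M + 1) => μ) (top i) :=
          (measure_mono hcover).trans (measure_iUnion_fintype_le _ _)
      _ ≤ ∑ _i : Fin (M + 1),
          ∫⁻ v in Set.Icc 0 m, ENNReal.ofReal (peelBound m ε (Real.exp d) c M v) :=
          Finset.sum_le_sum fun i _ => htop i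
      _ = ((M : ENNReal) + 1) *
          ∫⁻ v in Set.Icc 0 m, ENNReal.ofReal (peelBound m ε (Real.exp d) c M v) := by
          simp
      _ = _ := lintegral_peelBound M hε hεm (Real.exp_pos _).le hc1
      _ ≤ _ := by
          refine ENNReal.ofReal_le_ofReal ?_
          -- The choice 1 - c = 1/e makes each coordinate cost a factor e. The terms in (m -
          -- ε)^(M+1) have coefficient 1 - e^(d+1) ≤ 0 and can be dropped.
          have e1 : Real.exp d / (1 - c) = Real.exp ((d + 1 : ℕ) : ℝ) := by
            rw [hc, sub_sub_cancel, ← Real.exp_sub]; push_cast; congr 1; ring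
          rw [e1]
          have h1 : (1 : ℝ) ≤ Real.exp ((d + 1 : ℕ) : ℝ) := Real.one_le_exp (by positivity)
          have h2 : 0 ≤ (m - ε) ^ (M + 1) := pow_nonneg (by linarith) _
          nlinarith

/-- For fixed x, at most one value of the uniform variable solves the equation, so Fubini gives a
null set. -/
theorem prod_unitInterval_perturb_eq_zero {X : Type*} [MeasurableSpace X] (μ : Measure X)
    [IsFiniteMeasure μ] {a : X → ℝ} (ha : Measurable a) {η : ℝ} (hη : 0 < η) (t : ℝ) :
    (μ.prod (volume : Measure unitInterval)) {p | a p.1 + η * p.2 = t} = 0 := by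
  have hm : MeasurableSet {p : X × unitInterval | a p.1 + η * p.2 = t} := by
    refine measurableSet_eq_fun ?_ measurable_const
    exact (ha.comp measurable_fst).add ((measurable_subtype_coe.comp measurable_snd).const_mul η)
  rw [Measure.measure_prod_null hm]
  refine ae_of_all _ fun x => ?_
  refine Set.Subsingleton.measure_zero (fun l hl l' hl' => ?_) _
  have h1 : a x + η * l = t := hl
  have h2 : a x + η * l' = t := hl'
  exact Subtype.ext (mul_left_cancel₀ hη.ne' (by linarith))

/-- Tail bound for the probability of exceeding, in one of `d` coordinates, all of `M`
independent samples. -/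
theorem pi_exceedSet_le_of_isProbabilityMeasure {X : Type*} [MeasurableSpace X] {c : ℝ}
    (hc : c = 1 - Real.exp (-1)) {d M : ℕ} (μ : Measure X) [IsProbabilityMeasure μ]
    {a : Fin d → X → ℝ} (ha : ∀ j, Measurable (a j)) {ε : ℝ} (hε : 0 ≤ ε) (hε1 : ε ≤ 1) :
    Measure.pi (fun _ : Fin M => μ) {x | ε < μ.real (exceedSet a x)} ≤
      ENNReal.ofReal (Real.exp d * (1 - c * ε) ^ M) := by
  let η : ℕ → ℝ := fun n => 1 / ((n : ℝ) + 1)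
  have hη : ∀ n, 0 < η n := fun n => Nat.one_div_pos_of_nat
  have hηa : Antitone η := fun n k h => Nat.one_div_le_one_div h
  -- Exceeding with margin η survives any perturbation of size at most η. These sets increase to
  -- `exceedSet`, so the bound passes to the limit by continuity from below.
  let G : ℕ → (Fin M → X) → Set X := fun n x => {y | ∃ j, ∀ s, a j (x s) + η n < a j y}
  have hGm : ∀ n, MeasurableSet {p : (Fin M → X) × X | p.2 ∈ G n p.1} := by
    intro n
    have h : {p : (Fin M → X) × X | p.2 ∈ G n p.1} =
        ⋃ j, ⋂ s, {p | a j (p.1 s) + η n < a j p.2} := by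
      ext p; simp [G]
    rw [h]
    refine MeasurableSet.iUnion fun j => MeasurableSet.iInter fun s => ?_
    exact measurableSet_lt
      (((ha j).comp ((measurable_pi_apply s).comp measurable_fst)).add_const _)
      ((ha j).comp measurable_snd)
  have hGmono : ∀ x, Monotone fun n => G n x := by
    rintro x n k hnk y ⟨j, hj⟩
    exact ⟨j, fun s => by linarith [hj s, hηa hnk]⟩
  have hGU : ∀ x, ⋃ n, G n x = exceedSet a x := by
    intro x
    ext y
    simp only [Set.mem_iUnion]
    constructor
    · rintro ⟨n, j, hj⟩
      exact ⟨j, fun s => by linarith [hj s, hη n]⟩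
    · rintro ⟨j, hj⟩
      have h : ∀ s, ∀ᶠ n in Filter.atTop, a j (x s) + η n < a j y := by
        intro s
        have ht : Filter.Tendsto η Filter.atTop (nhds 0) := tendsto_one_div_add_atTop_nhds_zero_nat
        filter_upwards [ht.eventually_lt_const (sub_pos.2 (hj s))] with n hn
        linarith
      obtain ⟨n, hn⟩ := (Filter.eventually_all.2 h).exists
      exact ⟨n, j, hn⟩
  let E : ℕ → Set (Fin M → X) := fun n => {x | ε < μ.real (G n x)}
  have hEmono : Monotone E := fun n k hnk x hx =>
    lt_of_lt_of_le (show ε < _ from hx) (measureReal_mono (hGmono x hnk))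
  have hcover : {x | ε < μ.real (exceedSet a x)} ⊆ ⋃ n, E n := by
    intro x hx
    have h := tendsto_measure_iUnion_atTop (μ := μ) (hGmono x)
    rw [hGU] at h
    have h' := (ENNReal.tendsto_toReal (measure_ne_top _ _)).comp h
    obtain ⟨n, hn⟩ := (h'.eventually_const_lt (show ε < _ from hx)).exists
    exact Set.mem_iUnion.2 ⟨n, hn⟩
  refine (measure_mono hcover).trans ?_
  rw [hEmono.measure_iUnion]
  refine iSup_le fun n => ?_
  let b : Fin d → X × unitInterval → ℝ := fun j p => a j p.1 + η n * p.2
  have hb : ∀ j, Measurable (b j) := fun j =>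
    ((ha j).comp measurable_fst).add ((measurable_subtype_coe.comp measurable_snd).const_mul _)
  have hfst : (μ.prod (volume : Measure unitInterval)).map Prod.fst = μ := by
    simp
  have hEm : MeasurableSet (E n) :=
    measurableSet_lt measurable_const (measurable_measure_prodMk_left (hGm n)).ennreal_toReal
  have hpi : Measure.pi (fun _ : Fin M => μ) =
      (Measure.pi fun _ : Fin M => μ.prod (volume : Measure unitInterval)).map
        (fun p i => (p i).1) := by
    have : SigmaFinite ((μ.prod (volume : Measure unitInterval)).map Prod.fst) := by
      rw [hfst]; infer_instance
    rw [Measure.pi_map_pi fun _ => measurable_fst.aemeasurable, hfst]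
  have hmeas : Measurable fun (p : Fin M → X × unitInterval) i => (p i).1 := by fun_prop
  rw [hpi, Measure.map_apply hmeas hEm]
  have hmain := pi_exceedSet_le hc d M (μ.prod (volume : Measure unitInterval)) b hb
    (fun j t => prod_unitInterval_perturb_eq_zero μ (ha j) (hη n) t) ε hε (by simpa using hε1)
  rw [probReal_univ] at hmain
  refine (measure_mono fun p hp => ?_).trans hmain
  refine lt_of_lt_of_le (show ε < _ from hp) ?_
  have hsub : G n (fun i => (p i).1) ×ˢ Set.univ ⊆ exceedSet b p := by
    rintro ⟨y, l⟩ ⟨⟨j, hj⟩, -⟩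
    refine ⟨j, fun s => ?_⟩
    have h1 := hj s
    have h2 := mul_le_of_le_one_right (hη n).le (p s).2.2.2
    have h3 := mul_nonneg (hη n).le l.2.1
    simp only [b]
    linarith
  calc μ.real (G n fun i => (p i).1)
      = (μ.prod (volume : Measure unitInterval)).real (G n (fun i => (p i).1) ×ˢ Set.univ) := by
        rw [measureReal_prod_prod]; simp
    _ ≤ _ := measureReal_mono hsub

/-- The sample size of the theorem makes the tail bound at most `δ`. -/
theorem exp_mul_pow_le {d n M : ℕ} {ε δ c : ℝ} (hc : c = 1 - Real.exp (-1)) (hε : 0 < ε)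
    (hε1 : ε < 1) (hδ : 0 < δ)
    (hM : 1 / ε * (Real.exp 1 / (Real.exp 1 - 1)) * ((n : ℝ) + (d : ℝ) + Real.log (1 / δ))
      ≤ (M : ℝ)) :
    Real.exp d * (1 - c * ε) ^ M ≤ δ := by
  have he : 0 < Real.exp 1 - 1 := by linarith [Real.add_one_lt_exp (one_ne_zero (α := ℝ))]
  have hce : c = (Real.exp 1 - 1) / Real.exp 1 := by
    rw [hc, Real.exp_neg]; field_simp
  have hc0 : 0 < c := by rw [hce]; positivity
  have hc1 : c < 1 := by rw [hc]; linarith [Real.exp_pos (-1)]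
  -- The constant e / (e - 1) is 1 / c. Only d + log (1/δ) ≤ cεM is needed afterwards; n contributes
  -- a nonnegative surplus.
  have h1 : (n : ℝ) + d + Real.log (1 / δ) ≤ c * ε * M := by
    have : (n : ℝ) + d + Real.log (1 / δ) = c * ε *
        (1 / ε * (Real.exp 1 / (Real.exp 1 - 1)) * ((n : ℝ) + (d : ℝ) + Real.log (1 / δ))) := by
      rw [hce]; field_simp
    rw [this]
    exact mul_le_mul_of_nonneg_left hM (by positivity)
  have h2 : 0 ≤ 1 - c * ε := by nlinarith
  calc Real.exp d * (1 - c * ε) ^ M ≤ Real.exp d * Real.exp (-(c * ε)) ^ M := by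
        gcongr
        linarith [Real.add_one_le_exp (-(c * ε))]
    _ = Real.exp (d - c * ε * M) := by
        rw [← Real.exp_nat_mul, ← Real.exp_add]; congr 1; ring
    _ ≤ Real.exp (Real.log δ) := by
        refine Real.exp_le_exp.2 ?_
        rw [one_div, Real.log_inv] at h1
        have : (0 : ℝ) ≤ n := by positivity
        linarith
    _ = δ := Real.exp_log hδ

/-! ### Polytopes and learned sets -/

theorem mem_unitPolytope {m n : ℕ} {V : Matrix (Fin m) (Fin n) ℝ} {w : Fin n → ℝ} :
    w ∈ unitPolytope V ↔ ∀ j, (V *ᵥ w) j ≤ 1 := Iff.rfl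

theorem zero_mem_unitPolytope {m n : ℕ} (V : Matrix (Fin m) (Fin n) ℝ) :
    0 ∈ unitPolytope V := by
  simp [mem_unitPolytope]

/-- A bounded polytope has trivial recession cone. -/
theorem eq_zero_of_mulVec_nonpos {m n : ℕ} {V : Matrix (Fin m) (Fin n) ℝ}
    (hV : IsCompact (unitPolytope V)) {y : Fin n → ℝ} (hy : ∀ j, (V *ᵥ y) j ≤ 0) : y = 0 := by
  obtain ⟨R, hR⟩ := hV.isBounded.exists_norm_le
  by_contra hne
  have hpos : 0 < ‖y‖ := norm_pos_iff.2 hne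
  -- This multiple of y has norm |R| + 1, beyond the bound R.
  have hmem : ((|R| + 1) / ‖y‖) • y ∈ unitPolytope V := by
    rw [mem_unitPolytope]
    intro j
    rw [Matrix.mulVec_smul, Pi.smul_apply, smul_eq_mul]
    have : 0 ≤ (|R| + 1) / ‖y‖ := by positivity
    nlinarith [hy j]
  have h := hR _ hmem
  rw [norm_smul, Real.norm_of_nonneg (by positivity), div_mul_cancel₀ _ hpos.ne'] at h
  linarith [le_abs_self R]

/-- For r > 0 this is rescaling; at r = 0 it rests on the trivial recession cone. The value 0 must
be covered because ρ may be 1 and tube scalings may vanish. -/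
theorem mem_smul_unitPolytope {m n : ℕ} {V : Matrix (Fin m) (Fin n) ℝ}
    (hV : IsCompact (unitPolytope V)) {y : Fin n → ℝ} {r : ℝ} (hr : 0 ≤ r)
    (hy : ∀ j, (V *ᵥ y) j ≤ r) : ∃ v ∈ unitPolytope V, r • v = y := by
  rcases hr.eq_or_lt with rfl | hr
  · exact ⟨0, zero_mem_unitPolytope V, by rw [eq_zero_of_mulVec_nonpos hV hy, smul_zero]⟩
  · refine ⟨r⁻¹ • y, fun j => ?_, smul_inv_smul₀ hr.ne' y⟩
    rw [Matrix.mulVec_smul, Pi.smul_apply, smul_eq_mul, inv_mul_le_iff₀ hr]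
    simpa using hy j

theorem mulVec_le_maxOver {m n : ℕ} {X : Set (Fin n → ℝ)} (hX : IsCompact X)
    (L : Matrix (Fin m) (Fin n) ℝ) {e : Fin n → ℝ} (he : e ∈ X) (j : Fin m) :
    (L *ᵥ e) j ≤ maxOver X L j := by
  refine le_csSup ?_ ⟨e, he, rfl⟩
  refine (hX.image ?_).bddAbove
  exact (continuous_apply j).comp (Continuous.matrix_mulVec continuous_const continuous_id)

theorem maxOver_le {m n : ℕ} {X : Set (Fin n → ℝ)} (hX : X.Nonempty)
    {L : Matrix (Fin m) (Fin n) ℝ} {j : Fin m} {r : ℝ} (h : ∀ e ∈ X, (L *ᵥ e) j ≤ r) :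
    maxOver X L j ≤ r := by
  refine csSup_le (hX.image _) ?_
  rintro _ ⟨e, he, rfl⟩
  exact h e he

theorem mem_paramSet {nx nv : ℕ} {Vw : Matrix (Fin nv) (Fin nx) ℝ} {p : Params nx nv}
    {w : Fin nx → ℝ} : w ∈ paramSet Vw p ↔ Vw *ᵥ w ≤ paramLevel Vw p := by
  unfold paramSet paramLevel polyhedron
  rw [Set.add_singleton]
  constructor
  · rintro ⟨z, hz, rfl⟩
    intro j
    have := hz j
    simp only [Matrix.mulVec_add, Matrix.mulVec_smul, Pi.add_apply]
    linarith
  · intro h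
    refine ⟨w - (1 - p.2.2) • p.1, fun j => ?_, sub_add_cancel _ _⟩
    have := h j
    simp only [Matrix.mulVec_sub, Matrix.mulVec_smul, Pi.sub_apply, Pi.add_apply] at this ⊢
    linarith

theorem paramLevel_eq_of_linearized_eq {nx nv : ℕ} {Vw : Matrix (Fin nv) (Fin nx) ℝ}
    {p q : Params nx nv} (h : linearized p = linearized q) :
    paramLevel Vw p = paramLevel Vw q := by
  simp only [linearized, Prod.mk.injEq] at h
  unfold paramLevel
  rw [h.2.1, ← Matrix.mulVec_smul, ← Matrix.mulVec_smul, h.1]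

theorem paramSet_eq_of_linearized_eq {nx nv : ℕ} {Vw : Matrix (Fin nv) (Fin nx) ℝ}
    {p q : Params nx nv} (h : linearized p = linearized q) :
    paramSet Vw p = paramSet Vw q := by
  ext w
  rw [mem_paramSet, mem_paramSet, paramLevel_eq_of_linearized_eq h]

/-- Since θ ≤ ρ, each entry is at most ρ + (1 - ρ) = 1. -/
theorem paramLevel_le_one {nx nv : ℕ} {Vw : Matrix (Fin nv) (Fin nx) ℝ} {p : Params nx nv}
    (hp : p ∈ admissibleParams Vw) (j : Fin nv) : paramLevel Vw p j ≤ 1 := by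
  obtain ⟨hv, -, hρ, hθ⟩ := hp
  have h1 : (Vw *ᵥ p.1) j ≤ 1 := hv j
  have h2 := hθ j
  simp only [paramLevel, Pi.add_apply, Pi.smul_apply, smul_eq_mul]
  nlinarith [hρ.1, hρ.2]

theorem paramSet_subset {nx nv : ℕ} {Vw : Matrix (Fin nv) (Fin nx) ℝ} {p : Params nx nv}
    (hp : p ∈ admissibleParams Vw) : paramSet Vw p ⊆ unitPolytope Vw := fun _ hw j =>
  (mem_paramSet.1 hw j).trans (paramLevel_le_one hp j)

theorem paramSet_nonempty {nx nv : ℕ} {Vw : Matrix (Fin nv) (Fin nx) ℝ} {p : Params nx nv}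
    (hp : p ∈ admissibleParams Vw) : (paramSet Vw p).Nonempty := by
  refine ⟨(1 - p.2.2) • p.1, mem_paramSet.2 fun j => ?_⟩
  rw [Matrix.mulVec_smul]
  simp only [paramLevel, Pi.add_apply]
  linarith [(hp.2.1 j).1]

theorem continuous_mulVec_apply {m n : ℕ} (V : Matrix (Fin m) (Fin n) ℝ) (j : Fin m) :
    Continuous fun w => (V *ᵥ w) j :=
  (continuous_apply j).comp (Continuous.matrix_mulVec continuous_const continuous_id)

theorem isCompact_paramSet {nx nv : ℕ} {Vw : Matrix (Fin nv) (Fin nx) ℝ}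
    (hW : IsCompact (unitPolytope Vw)) {p : Params nx nv} (hp : p ∈ admissibleParams Vw) :
    IsCompact (paramSet Vw p) := by
  refine hW.of_isClosed_subset ?_ (paramSet_subset hp)
  have : paramSet Vw p = ⋂ j, {w | (Vw *ᵥ w) j ≤ paramLevel Vw p j} := by
    ext w; rw [mem_paramSet, Set.mem_iInter]; rfl
  rw [this]
  exact isClosed_iInter fun j => isClosed_le (continuous_mulVec_apply Vw j) continuous_const

/-! ### Existence and uniqueness of the selected minimiser -/

/-- The admissible parameters whose level vector dominates every vector in `L`. -/
def dominating {nx nv : ℕ} (Vw : Matrix (Fin nv) (Fin nx) ℝ) (L : Set (Fin nv → ℝ)) :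
    Set (Params nx nv) :=
  {p | p ∈ admissibleParams Vw ∧ ∀ l ∈ L, l ≤ paramLevel Vw p}

theorem initConstraints_eq_dominating {nx nv M : ℕ} (Vw : Matrix (Fin nv) (Fin nx) ℝ)
    (samples : Fin M → Fin nx → ℝ) :
    initConstraints Vw samples = dominating Vw (Set.range fun i => Vw *ᵥ samples i) := by
  ext p
  simp [initConstraints, dominating, and_comm]

theorem updateConstraints_eq_dominating {nx nv : ℕ} (Vw : Matrix (Fin nv) (Fin nx) ℝ)
    (prev : Params nx nv) (w : Fin nx → ℝ) :
    updateConstraints Vw prev w = dominating Vw {paramLevel Vw prev, Vw *ᵥ w} := by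
  ext p
  simp only [updateConstraints, dominating, Set.mem_insert_iff, Set.mem_singleton_iff,
    forall_eq_or_imp, forall_eq, Set.mem_ofPred_eq]
  tauto

/-- The image of `dominating Vw L` under `linearized`. -/
def linearizedDominating {nx nv : ℕ} (Vw : Matrix (Fin nv) (Fin nx) ℝ) (L : Set (Fin nv → ℝ)) :
    Set (Params nx nv) :=
  {q | (∀ j, (Vw *ᵥ q.1) j ≤ 1 - q.2.2) ∧ (∀ j, 0 ≤ q.2.1 j ∧ q.2.1 j ≤ 1) ∧
    (0 ≤ q.2.2 ∧ q.2.2 ≤ 1) ∧ (∀ j, q.2.1 j ≤ q.2.2) ∧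
    ∀ l ∈ L, ∀ j, l j ≤ q.2.1 j + (Vw *ᵥ q.1) j}

theorem linearized_mem {nx nv : ℕ} {Vw : Matrix (Fin nv) (Fin nx) ℝ} {L : Set (Fin nv → ℝ)}
    {p : Params nx nv} (hp : p ∈ dominating Vw L) : linearized p ∈ linearizedDominating Vw L := by
  obtain ⟨⟨hv, hθ, hρ, hθρ⟩, hL⟩ := hp
  refine ⟨fun j => ?_, hθ, hρ, hθρ, fun l hl j => ?_⟩
  · have h1 : (Vw *ᵥ p.1) j ≤ 1 := hv j
    simp only [linearized, Matrix.mulVec_smul, Pi.smul_apply, smul_eq_mul]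
    nlinarith [hρ.2]
  · have := hL l hl j
    simpa [linearized, Matrix.mulVec_smul, paramLevel] using this

theorem exists_linearized_eq {nx nv : ℕ} {Vw : Matrix (Fin nv) (Fin nx) ℝ}
    (hW : IsCompact (unitPolytope Vw)) {L : Set (Fin nv → ℝ)} {q : Params nx nv}
    (hq : q ∈ linearizedDominating Vw L) : ∃ p ∈ dominating Vw L, linearized p = q := by
  obtain ⟨hv, hθ, hρ, hθρ, hL⟩ := hq
  obtain ⟨v, hvW, hvq⟩ := mem_smul_unitPolytope hW (sub_nonneg.2 hρ.2) hv
  refine ⟨(v, q.2.1, q.2.2), ⟨⟨hvW, hθ, hρ, hθρ⟩, fun l hl j => ?_⟩, ?_⟩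
  · have := hL l hl j
    rw [← hvq] at this
    simpa [Matrix.mulVec_smul, paramLevel] using this
  · simp [linearized, hvq]

theorem isCompact_linearizedDominating {nx nv : ℕ} {Vw : Matrix (Fin nv) (Fin nx) ℝ}
    (hW : IsCompact (unitPolytope Vw)) (L : Set (Fin nv → ℝ)) :
    IsCompact (linearizedDominating Vw L) := by
  have hbox : IsCompact (unitPolytope Vw ×ˢ
      ((Set.univ.pi fun _ : Fin nv => Set.Icc (0 : ℝ) 1) ×ˢ Set.Icc (0 : ℝ) 1)) :=
    hW.prod ((isCompact_univ_pi fun _ => isCompact_Icc).prod isCompact_Icc)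
  refine hbox.of_isClosed_subset ?_ ?_
  · have hc : ∀ j, Continuous fun q : Params nx nv => (Vw *ᵥ q.1) j := fun j =>
      (continuous_mulVec_apply Vw j).comp continuous_fst
    have hθ : ∀ j, Continuous fun q : Params nx nv => q.2.1 j := fun j => by fun_prop
    have hρ : Continuous fun q : Params nx nv => q.2.2 := by fun_prop
    simp only [linearizedDominating, Set.ofPred_and, Set.ofPred_forall]
    refine IsClosed.inter (isClosed_iInter fun j => isClosed_le (hc j) (by fun_prop)) ?_
    refine IsClosed.inter (isClosed_iInter fun j => (isClosed_le continuous_const (hθ j)).inter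
      (isClosed_le (hθ j) continuous_const)) ?_
    refine IsClosed.inter ((isClosed_le continuous_const hρ).inter
      (isClosed_le hρ continuous_const)) ?_
    refine IsClosed.inter (isClosed_iInter fun j => isClosed_le (hθ j) hρ) ?_
    exact isClosed_biInter fun l _ => isClosed_iInter fun j =>
      isClosed_le continuous_const ((hθ j).add (hc j))
  · rintro q ⟨hv, hθ, hρ, -, -⟩
    exact ⟨fun j => (hv j).trans (by linarith [hρ.1]), fun j _ => hθ j, hρ⟩

theorem convex_linearizedDominating {nx nv : ℕ} (Vw : Matrix (Fin nv) (Fin nx) ℝ)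
    (L : Set (Fin nv → ℝ)) : Convex ℝ (linearizedDominating Vw L) := by
  rintro p ⟨hp1, hp2, hp3, hp4, hp5⟩ q ⟨hq1, hq2, hq3, hq4, hq5⟩ a b ha hb hab
  have hb' : b = 1 - a := by linarith
  subst hb'
  simp only [linearizedDominating, Set.mem_ofPred_eq, Prod.fst_add, Prod.snd_add, Prod.smul_fst,
    Prod.smul_snd, Matrix.mulVec_add, Matrix.mulVec_smul, Pi.add_apply, Pi.smul_apply, smul_eq_mul]
  have comb : ∀ {x y x' y' : ℝ}, x ≤ y → x' ≤ y' →
      a * x + (1 - a) * x' ≤ a * y + (1 - a) * y' := fun h h' =>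
    add_le_add (mul_le_mul_of_nonneg_left h ha) (mul_le_mul_of_nonneg_left h' hb)
  refine ⟨fun j => ?_, fun j => ⟨?_, ?_⟩, ⟨?_, ?_⟩, fun j => ?_, fun l hl j => ?_⟩
  · linarith [comb (hp1 j) (hq1 j)]
  · linarith [comb (hp2 j).1 (hq2 j).1]
  · linarith [comb (hp2 j).2 (hq2 j).2]
  · linarith [comb hp3.1 hq3.1]
  · linarith [comb hp3.2 hq3.2]
  · exact comb (hp4 j) (hq4 j)
  · linarith [comb (hp5 l hl j) (hq5 l hl j)]

theorem continuous_paramCost {nx nv : ℕ} : Continuous (paramCost : Params nx nv → ℝ) := by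
  unfold paramCost; fun_prop

theorem paramCost_linearized {nx nv : ℕ} (p : Params nx nv) :
    paramCost (linearized p) = paramCost p := rfl

/-- The constraints are bilinear in (v, θ, ρ), and v is unconstrained by the cost, so both
minimisations take place in the linearised coordinates, where the region is compact; `t` is
continuous, being convex in finite dimension. -/
theorem exists_isSelectedMin {nx nv : ℕ} {Vw : Matrix (Fin nv) (Fin nx) ℝ}
    (hW : IsCompact (unitPolytope Vw)) {t : Params nx nv → ℝ}
    (ht : StrictConvexOn ℝ Set.univ t) {L : Set (Fin nv → ℝ)} (hL : ∀ l ∈ L, ∀ j, l j ≤ 1) :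
    ∃ p, IsSelectedMin t (dominating Vw L) p := by
  have htc : Continuous t := continuousOn_univ.1 (ht.convexOn.continuousOn isOpen_univ)
  have hK := isCompact_linearizedDominating hW L
  have hne : (linearizedDominating Vw L).Nonempty := by
    -- This point represents the whole bounding polytope.
    refine ⟨(0, fun _ => 1, 1), ?_⟩
    simpa [linearizedDominating] using hL
  obtain ⟨q₀, hq₀, hmin₀⟩ := hK.exists_isMinOn hne continuous_paramCost.continuousOn
  have hK' : IsCompact (linearizedDominating Vw L ∩ {q | paramCost q ≤ paramCost q₀}) :=
    hK.inter_right (isClosed_le continuous_paramCost continuous_const)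
  obtain ⟨q, hq, hmin⟩ := hK'.exists_isMinOn ⟨q₀, hq₀, le_refl (paramCost q₀)⟩ htc.continuousOn
  obtain ⟨p, hp, rfl⟩ := exists_linearized_eq hW hq.1
  have hpq : paramCost p ≤ paramCost q₀ := hq.2
  refine ⟨p, hp, fun r hr => ?_, fun r hr hrp => ?_⟩
  · exact hpq.trans (isMinOn_iff.1 hmin₀ (linearized r) (linearized_mem hr))
  · exact isMinOn_iff.1 hmin (linearized r) ⟨linearized_mem hr, hrp.trans_le hpq⟩

/-- The midpoint of two distinct selected points would have the same cost and a strictly smaller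
tie-break value. Uniqueness cannot extend to v itself: at ρ = 1 it is arbitrary. -/
theorem IsSelectedMin.linearized_eq {nx nv : ℕ} {Vw : Matrix (Fin nv) (Fin nx) ℝ}
    (hW : IsCompact (unitPolytope Vw)) {t : Params nx nv → ℝ}
    (ht : StrictConvexOn ℝ Set.univ t) {L : Set (Fin nv → ℝ)} {p q : Params nx nv}
    (hp : IsSelectedMin t (dominating Vw L) p) (hq : IsSelectedMin t (dominating Vw L) q) :
    linearized p = linearized q := by
  by_contra hne
  have hcost : paramCost q = paramCost p := le_antisymm (hq.2.1 p hp.1) (hp.2.1 q hq.1)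
  have htt : t (linearized q) = t (linearized p) :=
    le_antisymm (hq.2.2 p hp.1 hcost.symm) (hp.2.2 q hq.1 hcost)
  have hmid := convex_linearizedDominating Vw L (linearized_mem hp.1) (linearized_mem hq.1)
    (by norm_num : (0 : ℝ) ≤ 1 / 2) (by norm_num : (0 : ℝ) ≤ 1 / 2) (by norm_num)
  obtain ⟨r, hr, hrm⟩ := exists_linearized_eq hW hmid
  have hrcost : paramCost r = paramCost p := by
    have hlin : ∀ x y : Params nx nv, paramCost ((1 / 2 : ℝ) • x + (1 / 2 : ℝ) • y) =
        1 / 2 * paramCost x + 1 / 2 * paramCost y := by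
      intro x y
      simp only [paramCost, Prod.snd_add, Prod.fst_add, Prod.smul_fst, Prod.smul_snd, Pi.add_apply,
        Pi.smul_apply, smul_eq_mul, Finset.sum_add_distrib, ← Finset.mul_sum]
      ring
    rw [← paramCost_linearized r, hrm, hlin, paramCost_linearized, paramCost_linearized, hcost]
    ring
  have h1 := hp.2.2 r hr hrcost
  have h2 := ht.2 (Set.mem_univ (linearized p)) (Set.mem_univ (linearized q)) hne
    (by norm_num : (0 : ℝ) < 1 / 2) (by norm_num : (0 : ℝ) < 1 / 2) (by norm_num)
  rw [hrm] at h1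
  rw [htt] at h2
  simp only [smul_eq_mul] at h2
  linarith

theorem selectMin_spec {nx nv : ℕ} {Vw : Matrix (Fin nv) (Fin nx) ℝ}
    (hW : IsCompact (unitPolytope Vw)) {t : Params nx nv → ℝ}
    (ht : StrictConvexOn ℝ Set.univ t) {L : Set (Fin nv → ℝ)} (hL : ∀ l ∈ L, ∀ j, l j ≤ 1) :
    IsSelectedMin t (dominating Vw L) (selectMin t (dominating Vw L)) :=
  Classical.epsilon_spec (exists_isSelectedMin hW ht hL)

theorem nextParams_spec {nx nv : ℕ} {Vw : Matrix (Fin nv) (Fin nx) ℝ}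
    (hW : IsCompact (unitPolytope Vw)) {t : Params nx nv → ℝ}
    (ht : StrictConvexOn ℝ Set.univ t) {p : Params nx nv} (hp : p ∈ admissibleParams Vw)
    {w : Fin nx → ℝ} (hw : w ∈ unitPolytope Vw) :
    IsSelectedMin t (dominating Vw {paramLevel Vw p, Vw *ᵥ w}) (nextParams Vw t p w) := by
  unfold nextParams
  rw [updateConstraints_eq_dominating]
  refine selectMin_spec hW ht ?_
  rintro l (rfl | rfl)
  · exact paramLevel_le_one hp
  · exact hw

/-- A disturbance inside the learned set leaves the learned set unchanged. -/
theorem paramSet_nextParams_eq {nx nv : ℕ} {Vw : Matrix (Fin nv) (Fin nx) ℝ}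
    (hW : IsCompact (unitPolytope Vw)) {t : Params nx nv → ℝ}
    (ht : StrictConvexOn ℝ Set.univ t) {L : Set (Fin nv → ℝ)} {p : Params nx nv}
    (hp : IsSelectedMin t (dominating Vw L) p) {w : Fin nx → ℝ} (hw : w ∈ paramSet Vw p) :
    paramSet Vw (nextParams Vw t p w) = paramSet Vw p := by
  -- The old level already dominates `L`, so the update shrinks the feasible region; a selected
  -- minimiser that stays feasible remains selected.
  have hsub : dominating Vw {paramLevel Vw p, Vw *ᵥ w} ⊆ dominating Vw L := fun q hq =>
    ⟨hq.1, fun l hl => (hp.1.2 l hl).trans (hq.2 _ (Or.inl rfl))⟩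
  have hp' : IsSelectedMin t (dominating Vw {paramLevel Vw p, Vw *ᵥ w}) p := by
    refine ⟨⟨hp.1.1, ?_⟩, fun q hq => hp.2.1 q (hsub hq), fun q hq => hp.2.2 q (hsub hq)⟩
    rintro l (rfl | rfl)
    · exact le_rfl
    · exact mem_paramSet.1 hw
  exact paramSet_eq_of_linearized_eq
    ((nextParams_spec hW ht hp.1.1 (paramSet_subset hp.1.1 hw)).linearized_eq hW ht hp')

/-- As long as all data lie in the bounding polytope, the learned parameters solve a problem of
the form `dominating`, and the learned sets contain the initial one and the samples. -/
theorem learnedParams_spec {nx nv M : ℕ} {Vw : Matrix (Fin nv) (Fin nx) ℝ}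
    (hW : IsCompact (unitPolytope Vw)) {t : Params nx nv → ℝ}
    (ht : StrictConvexOn ℝ Set.univ t) {samples : Fin M → Fin nx → ℝ} {w : ℕ → Fin nx → ℝ}
    (hs : ∀ i, samples i ∈ unitPolytope Vw) (hw : ∀ k, w k ∈ unitPolytope Vw) (k : ℕ) :
    (∃ L, IsSelectedMin t (dominating Vw L) (learnedParams Vw t samples w k)) ∧
      paramLevel Vw (learnedParams Vw t samples w 0) ≤
        paramLevel Vw (learnedParams Vw t samples w k) ∧
      ∀ i, Vw *ᵥ samples i ≤ paramLevel Vw (learnedParams Vw t samples w k) := by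
  induction k with
  | zero =>
    have h : IsSelectedMin t (dominating Vw (Set.range fun i => Vw *ᵥ samples i))
        (learnedParams Vw t samples w 0) := by
      unfold learnedParams
      rw [initConstraints_eq_dominating]
      refine selectMin_spec hW ht ?_
      rintro _ ⟨i, rfl⟩
      exact hs i
    exact ⟨⟨_, h⟩, le_rfl, fun i => h.1.2 _ ⟨i, rfl⟩⟩
  | succ k ih =>
    obtain ⟨⟨L, hL⟩, h0, hi⟩ := ih
    have h := nextParams_spec hW ht hL.1.1 (hw k)
    have hle := h.1.2 _ (Or.inl rfl)
    exact ⟨⟨_, h⟩, h0.trans hle, fun i => (hi i).trans hle⟩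

/-! ### Recursive feasibility of the homothetic tube -/

namespace TubeData

variable {nx nu nc ns : ℕ} (D : TubeData nx nu nc ns) (N : ℕ)

/-- The tube constraints are antitone in the disturbance bound. -/
theorem tubeConstraints_anti {wm wm' : Fin ns → ℝ} (h : wm ≤ wm') (n : ℕ) :
    D.tubeConstraints N wm' n ⊆ D.tubeConstraints N wm n := fun _ hq =>
  ⟨hq.1, fun i hi j => le_trans (by linarith [h j]) (hq.2.1 i hi j), hq.2.2⟩

theorem wMax_mono {X Y : Set (Fin nx → ℝ)} (hX : X.Nonempty) (hY : IsCompact Y) (h : X ⊆ Y) :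
    D.wMax X ≤ D.wMax Y := fun j =>
  maxOver_le hX fun _ he => mulVec_le_maxOver hY D.Vs (h he) j

/-- Robust invariance of the base set of the tube, in terms of `eMax` and `wMax`. -/
theorem eMax_add_wMax_le_one {W X : Set (Fin nx → ℝ)}
    (hinv : (fun e => D.Phi *ᵥ e) '' D.baseSet + W ⊆ D.baseSet) (hX : X.Nonempty) (hXW : X ⊆ W)
    (j : Fin ns) : D.eMax j + D.wMax X j ≤ 1 := by
  suffices h : ∀ w ∈ X, D.eMax j + (D.Vs *ᵥ w) j ≤ 1 by
    have : D.wMax X j ≤ 1 - D.eMax j := maxOver_le hX fun w hw => by linarith [h w hw]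
    linarith
  intro w hw
  have hS0 : D.baseSet.Nonempty := ⟨0, zero_mem_unitPolytope D.Vs⟩
  suffices h : D.eMax j ≤ 1 - (D.Vs *ᵥ w) j by linarith
  refine maxOver_le hS0 fun e he => ?_
  have h := hinv (Set.add_mem_add ⟨e, he, rfl⟩ (hXW hw)) j
  rw [Matrix.mulVec_add, Pi.add_apply, Matrix.mulVec_mulVec] at h
  linarith

/-- Recursive feasibility of the tube problem for disturbances in the set that it uses. -/
theorem isFeasible_nextState (hN : 1 ≤ N) {X X₀ W : Set (Fin nx → ℝ)} (hS : IsCompact D.baseSet)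
    (hinv : (fun e => D.Phi *ᵥ e) '' D.baseSet + W ⊆ D.baseSet) (hXW : X ⊆ W)
    (hX : IsCompact X) (hX₀ : X₀.Nonempty) (hX₀X : X₀ ⊆ X) {ν : ℕ}
    (hν : ν ∈ D.horizons N (D.wMax X₀)) {x s : Fin nx → ℝ} {c : Fin N × Fin nu → ℝ} {α : ℕ → ℝ}
    (h : D.IsFeasiblePoint N X ν x s c α) {w : Fin nx → ℝ} (hw : w ∈ X) :
    D.IsFeasible N X ν (D.nextState N x c w) := by
  obtain ⟨hxs, hq⟩ := h
  have hXne : X.Nonempty := hX₀.mono hX₀X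
  obtain ⟨hF, hα, hα0, hα1⟩ := hq
  obtain ⟨e, he, hex⟩ := hxs
  simp only at hex hF hα hα0 hα1
  set z := D.Psi N *ᵥ Sum.elim s c with hz
  have hzi : z ∘ Sum.inl = D.Phi *ᵥ s + D.B *ᵥ (firstBlock N nu *ᵥ c) := by
    rw [hz, Psi, Matrix.fromBlocks_mulVec, Sum.elim_comp_inl, Sum.elim_comp_inl,
      Sum.elim_comp_inr, Matrix.mulVec_mulVec]
  have hpow : ∀ i, (D.FBar N * D.Psi N ^ i) *ᵥ z =
      (D.FBar N * D.Psi N ^ (i + 1)) *ᵥ Sum.elim s c := by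
    intro i
    rw [hz, Matrix.mulVec_mulVec, Matrix.mul_assoc, ← pow_succ]
  -- The candidate is the shifted tube: Ψ applied to (s, c), with each scaling moved forward by one.
  refine ⟨z ∘ Sum.inl, z ∘ Sum.inr, fun i => α (i + 1), ?_, ?_⟩
  · have herr : D.nextState N x c w - z ∘ Sum.inl = α 0 • (D.Phi *ᵥ e) + w := by
      rw [hzi, ← Matrix.mulVec_smul, hex, nextState, Matrix.mulVec_sub, Phi, Matrix.add_mulVec,
        Matrix.add_mulVec, Matrix.mulVec_add, Matrix.mulVec_mulVec]
      abel
    rw [herr]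
    obtain ⟨v, hv, hve⟩ := mem_smul_unitPolytope (V := D.Vs) hS (hα0 1)
      (y := α 0 • (D.Phi *ᵥ e) + w) fun j => by
        have h1 : ((D.Vs * D.Phi) *ᵥ e) j ≤ D.eMax j := mulVec_le_maxOver hS _ he j
        have h2 : (D.Vs *ᵥ w) j ≤ D.wMax X j := mulVec_le_maxOver hX _ hw j
        have h3 := hα 0 hN j
        have h4 := mul_le_mul_of_nonneg_left h1 (hα0 0)
        rw [Matrix.mulVec_add, Matrix.mulVec_smul, Matrix.mulVec_mulVec]
        simp only [Pi.add_apply, Pi.smul_apply, smul_eq_mul]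
        simp only [zero_add] at h3
        linarith
    exact ⟨v, hv, hve⟩
  · rw [Sum.elim_comp_inl_inr]
    refine ⟨fun i hi j => ?_, fun i hi j => ?_, fun i => hα0 _, fun i hi => hα1 _ (by omega)⟩
    · simp only
      rw [hpow]
      rcases hi.lt_or_eq with hi | rfl
      · exact hF (i + 1) hi j
      -- The last stage asks for one power of Ψ beyond the given constraints, which is what the
      -- horizon provides; N ≤ ν + 1 makes the scaling 1.
      · rw [hα1 (i + 1) hν.1, one_mul]
        exact hν.2 (Sum.elim s c, α) (D.tubeConstraints_anti N (D.wMax_mono hX₀ hX hX₀X) i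
          ⟨hF, hα, hα0, hα1⟩) j
    · simp only
      rcases (Nat.succ_le_of_lt hi).lt_or_eq with hi' | hi'
      · exact hα (i + 1) hi' j
      -- At i = N - 1 both scalings are 1, and robust invariance of the base set closes the
      -- inequality.
      · rw [hα1 (i + 1) (by omega), hα1 (i + 1 + 1) (by omega), one_mul]
        exact D.eMax_add_wMax_le_one hinv hXne hXW j

end TubeData

/-! ### Combining the two parts -/

/-- If the samples are not exceeded with probability more than `ε`, then the tube problem stays
feasible with probability at least `1 - ε`. -/
theorem measure_not_isFeasible_le {nx nu nc ns nv N M : ℕ} (hN : 1 ≤ N)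
    (D : TubeData nx nu nc ns) (Vw : Matrix (Fin nv) (Fin nx) ℝ)
    (hW : IsCompact (unitPolytope Vw)) (hS : IsCompact D.baseSet)
    (hinv : (fun e => D.Phi *ᵥ e) '' D.baseSet + unitPolytope Vw ⊆ D.baseSet)
    (Pr : Measure (Fin nx → ℝ)) [IsProbabilityMeasure Pr]
    {t : Params nx nv → ℝ} (ht : StrictConvexOn ℝ Set.univ t)
    {samples : Fin M → Fin nx → ℝ} {w : ℕ → Fin nx → ℝ}
    (hs : ∀ i, samples i ∈ unitPolytope Vw) (hw : ∀ k, w k ∈ unitPolytope Vw) {ε : ℝ}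
    (hε : Pr.real (exceedSet (fun j y => (Vw *ᵥ y) j) samples) ≤ ε) {ν : ℕ}
    (hν : ν ∈ D.horizons N (D.wMax (paramSet Vw (learnedParams Vw t samples w 0))))
    (k : ℕ) {x s : Fin nx → ℝ} {c : Fin N × Fin nu → ℝ} {α : ℕ → ℝ}
    (h : D.IsFeasiblePoint N (paramSet Vw (learnedParams Vw t samples w k)) ν x s c α) :
    Pr {w' | ¬ D.IsFeasible N (paramSet Vw (nextParams Vw t (learnedParams Vw t samples w k) w')) ν
      (D.nextState N x c w')} ≤ ENNReal.ofReal ε := by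
  obtain ⟨⟨L₀, hL₀⟩, -, -⟩ := learnedParams_spec hW ht hs hw 0
  obtain ⟨⟨L, hL⟩, h0, hsamp⟩ := learnedParams_spec hW ht hs hw k
  refine le_trans (measure_mono fun w' hw' => ?_)
    ((ofReal_measureReal (μ := Pr)
      (s := exceedSet (fun j y => (Vw *ᵥ y) j) samples)).symm.trans_le
      (ENNReal.ofReal_le_ofReal hε))
  by_contra hnot
  refine hw' ?_
  -- A violated row of the learned set is one in which `w'` exceeds every sample, since the level
  -- dominates them all.
  have hmem : w' ∈ paramSet Vw (learnedParams Vw t samples w k) := by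
    rw [mem_paramSet]
    intro j
    by_contra hj
    exact hnot ⟨j, fun i => (hsamp i j).trans_lt (not_le.1 hj)⟩
  rw [paramSet_nextParams_eq hW ht hL hmem]
  exact D.isFeasible_nextState N hN hS hinv (paramSet_subset hL.1.1)
    (isCompact_paramSet hW hL.1.1) (paramSet_nonempty hL₀.1.1)
    (fun y hy => mem_paramSet.2 ((mem_paramSet.1 hy).trans h0)) hν h hmem

end

theorem proposition2
    {nx nu nc ns nv N M : ℕ} (hN : 1 ≤ N)
    (D : TubeData nx nu nc ns) (Vw : Matrix (Fin nv) (Fin nx) ℝ)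
    (hW : IsCompact (unitPolytope Vw))
    (hS : IsCompact D.baseSet)
    (hinv : (fun e => D.Phi *ᵥ e) '' D.baseSet + unitPolytope Vw ⊆ D.baseSet)
    -- the unknown law of the disturbance and its support
    (Pr : Measure (Fin nx → ℝ)) [IsProbabilityMeasure Pr]
    (Wtrue : Set (Fin nx → ℝ)) (hsupp : Pr.support = Wtrue) (hsub : Wtrue ⊆ unitPolytope Vw)
    -- offline samples and online disturbances, jointly i.i.d. with that law
    {Ω : Type*} [MeasurableSpace Ω] (P : Measure Ω) [IsProbabilityMeasure P]
    (samples : Fin M → Ω → Fin nx → ℝ) (w : ℕ → Ω → Fin nx → ℝ)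
    (hsm : ∀ i, Measurable (samples i)) (hwm : ∀ k, Measurable (w k))
    (hslaw : ∀ i, P.map (samples i) = Pr) (hwlaw : ∀ k, P.map (w k) = Pr)
    (hindep : iIndepFun (Sum.elim samples w) P)
    -- tie-break rule between optimal parameters
    (t : Params nx nv → ℝ) (ht : StrictConvexOn ℝ Set.univ t)
    (ε δ : ℝ) (hε : ε ∈ Set.Ioo (0 : ℝ) 1) (hδ : δ ∈ Set.Ioo (0 : ℝ) 1)
    (hM : 1 / ε * (Real.exp 1 / (Real.exp 1 - 1)) * ((nx : ℝ) + (nv : ℝ) + Real.log (1 / δ))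
      ≤ (M : ℝ)) :
    -- outside an event of probability at most `δ` ...
    P {ω | ¬ ∀ ν : ℕ,
        let par : ℕ → Params nx nv :=
          learnedParams Vw t (fun i => samples i ω) (fun k => w k ω)
        IsLeast (D.horizons N (D.wMax (paramSet Vw (par 0)))) ν →
        ∀ (k : ℕ) (x s : Fin nx → ℝ) (c : Fin N × Fin nu → ℝ) (α : ℕ → ℝ),
          -- ... if the problem at time `k` has the feasible point `(s, c, α)` ...
          D.IsFeasiblePoint N (paramSet Vw (par k)) ν x s c α →
          -- ... then a disturbance `w'` with law `Pr` acting at time `k` makes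
          -- the problem at time `k + 1` infeasible with probability at most `ε`
          Pr {w' | ¬ D.IsFeasible N (paramSet Vw (nextParams Vw t (par k) w')) ν
            (D.nextState N x c w')} ≤ ENNReal.ofReal ε}
      ≤ ENNReal.ofReal δ := by
  have hae : ∀ᵐ y ∂Pr, y ∈ unitPolytope Vw := by
    filter_upwards [Measure.support_mem_ae (μ := Pr)] with y hy using hsub (hsupp ▸ hy)
  have haes : ∀ᵐ ω ∂P, ∀ i, samples i ω ∈ unitPolytope Vw := ae_all_iff.2 fun i =>
    ae_of_ae_map (hsm i).aemeasurable (by rw [hslaw i]; exact hae)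
  have haew : ∀ᵐ ω ∂P, ∀ k, w k ω ∈ unitPolytope Vw := ae_all_iff.2 fun k =>
    ae_of_ae_map (hwm k).aemeasurable (by rw [hwlaw k]; exact hae)
  have hlaw : P.map (fun ω i => samples i ω) = Measure.pi fun _ : Fin M => Pr := by
    have h := hindep.precomp (g := Sum.inl) Sum.inl_injective
    have h' := (iIndepFun_iff_map_fun_eq_pi_map fun i => (hsm i).aemeasurable).1 h
    simpa only [Sum.elim_inl, hslaw] using h'
  have hVm : ∀ j, Measurable fun y : Fin nx → ℝ => (Vw *ᵥ y) j := fun j =>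
    (continuous_mulVec_apply Vw j).measurable
  have htail : P {ω | ε < Pr.real (exceedSet (fun j y => (Vw *ᵥ y) j) fun i => samples i ω)} ≤
      ENNReal.ofReal δ := by
    have hE : MeasurableSet {x : Fin M → Fin nx → ℝ |
        ε < Pr.real (exceedSet (fun j y => (Vw *ᵥ y) j) x)} :=
      measurableSet_lt measurable_const (measurable_measureReal_exceedSet Pr hVm)
    have hpi := pi_exceedSet_le_of_isProbabilityMeasure (M := M) rfl Pr hVm hε.1.le hε.2.le
    rw [← hlaw, Measure.map_apply (measurable_pi_lambda _ hsm) hE] at hpi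
    exact hpi.trans (ENNReal.ofReal_le_ofReal (exp_mul_pow_le rfl hε.1 hε.2 hδ.1 hM))
  -- The failure event is not shown to be measurable; it suffices that, up to a null set, it lies in
  -- the tail event.
  refine le_trans (measure_mono_ae ?_) htail
  filter_upwards [haes, haew] with ω hs hw hbad
  by_contra hle
  refine hbad ?_
  intro ν par hν k x s c α h
  exact measure_not_isFeasible_le hN D Vw hW hS hinv Pr ht hs hw (not_lt.1 hle) hν.1 k h
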